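/- Fix $d\in\mathbb N$. A density operator is a positive semidefinite $\rho\in\mathbb C^{d\times d}$ with $\operatorname{Tr}\rho=1$. For operators $A,B$ write $A\ll B$ if $\operatorname{supp}A\subseteq\operatorname{supp}B$, where $\operatorname{supp}A=(\ker A)^\perp$. For a Hermitian operator $A$ let $A^{-1}$ denote its Moore–Penrose inverse, and let $\log A$ act as $0$ on $\ker A$. The quantum relative entropy is $D(\rho\|\sigma)=\operatorname{Tr}[\rho(\log\rho-\log\sigma)]$ if $\rho\ll\sigma$, and $D(\rho\|\sigma)=\infty$ otherwise. Weak convergence $\Rightarrow$ means convergence of the expectations of all bounded continuous functions (convergence in distribution). Let $\rho,\sigma$ be density operators, let $\rho_n,\sigma_n$ ($n\in\mathbb N$) be random density operators (Borel-measurable maps from a probability space $(\Omega,\mathcal A,\mathbb P)$ to the density operators), and let $(r_n)$ be a sequence of positive reals with $r_n\to\infty$. Assume that $\rho\ll\sigma$ and that, for every $n$, $\rho_n\ll\sigma_n\ll\sigma$ and $\rho_n\ll\rho$ almost surely. Assume that the operators commute, that is, $[\rho,\sigma]=0$ and, for every $n$, $[\rho_n,\sigma_n]=[\rho_n,\rho]=[\rho_n,\sigma]=[\sigma_n,\rho]=[\sigma_n,\sigma]=0$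 almost surely. Let $(L_1,L_2)$ be a random pair of operators in $\mathbb C^{d\times d}$ (possibly on another probability space) such that $$\big(r_n(\rho_n-\rho),\,r_n(\sigma_n-\sigma)\big)\Rightarrow(L_1,L_2).$$ Then $D(\rho\|\sigma)<\infty$, $D(\rho_n\|\sigma_n)<\infty$ almost surely for every $n$, and the following hold. (i) The trace $\operatorname{Tr}\big[L_1(\log\rho-\log\sigma)-L_2\,\rho\,\sigma^{-1}\big]$ is almost surely real, and $$r_n\big(D(\rho_n\|\sigma_n)-D(\rho\|\sigma)\big)\Rightarrow\operatorname{Tr}\big[L_1(\log\rho-\log\sigma)-L_2\,\rho\,\sigma^{-1}\big].$$ (ii) If moreover $\rho=\sigma$, then $\operatorname{Tr}\big[(L_1-L_2)^2\rho^{-1}\big]$ is almost surely real, and $$r_n^2\,D(\rho_n\|\sigma_n)\Rightarrow\tfrac12\operatorname{Tr}\big[(L_1-L_2)^2\rho^{-1}\big].$$ -/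

import Mathlib

open MeasureTheory ProbabilityTheory Filter Topology
open scoped ComplexOrder

namespace QuantumStat

/-- The linear operators on `ℂ^d`, identified with the complex `d × d` matrices; the topology is the
usual (norm) topology. -/
abbrev Op (d : ℕ) := Matrix (Fin d) (Fin d) ℂ

/-- The Borel σ-algebra of the space of operators. -/
noncomputable instance instMeasurableSpaceOp (d : ℕ) : MeasurableSpace (Op d) := borel (Op d)

instance instBorelSpaceOp (d : ℕ) : BorelSpace (Op d) := ⟨rfl⟩

instance instSecondCountableTopologyOp (d : ℕ) : SecondCountableTopology (Op d) :=
  inferInstanceAs (SecondCountableTopology (Fin d → Fin d → ℂ))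

/-- Density operators: positive semidefinite operators of trace one. -/
def IsDensityOperator {d : ℕ} (ρ : Op d) : Prop :=
  ρ.PosSemidef ∧ ρ.trace = 1

/-- The support of an operator: the orthogonal complement of its kernel. -/
noncomputable def support {d : ℕ} (A : Op d) : Submodule ℂ (EuclideanSpace ℂ (Fin d)) :=
  (LinearMap.ker (Matrix.toEuclideanLin A))ᗮ

/-- `A ≪ B`: the support of `A` is contained in the support of `B`. -/
def SuppLE {d : ℕ} (A B : Op d) : Prop :=
  support A ≤ support B

/-- The logarithm of a Hermitian operator, acting as the zero operator on the kernel
(`Real.log 0 = 0`). -/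
noncomputable def opLog {d : ℕ} (A : Op d) : Op d :=
  cfc Real.log A

/-- The generalized (Moore–Penrose) inverse of a Hermitian operator: each nonzero eigenvalue `x` is
replaced by `x⁻¹`, and the kernel is kept (`(0 : ℝ)⁻¹ = 0`). -/
noncomputable def pinv {d : ℕ} (A : Op d) : Op d :=
  cfc (fun x : ℝ => x⁻¹) A

/-- The four Penrose equations, which characterize the Moore–Penrose inverse, hold for `pinv`. -/
theorem pinv_penrose {d : ℕ} (A : Op d) (hA : A.IsHermitian) :
    A * pinv A * A = A ∧ pinv A * A * pinv A = pinv A ∧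
      (A * pinv A).IsHermitian ∧ (pinv A * A).IsHermitian := by
  have hA' : IsSelfAdjoint A := hA
  have hc : ∀ f : ℝ → ℝ, ContinuousOn f (spectrum ℝ A) := fun f =>
    (Matrix.finite_real_spectrum (A := A)).continuousOn f
  have hid : A = cfc (fun x : ℝ => x) A := (cfc_id' ℝ A hA').symm
  have h1 : A * pinv A = cfc (fun x : ℝ => x * x⁻¹) A := by
    rw [cfc_mul _ _ A (hc _) (hc _), ← hid]; rfl
  have h2 : pinv A * A = cfc (fun x : ℝ => x⁻¹ * x) A := by
    rw [cfc_mul _ _ A (hc _) (hc _), ← hid]; rfl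
  refine ⟨?_, ?_, ?_, ?_⟩
  · have h3 : A * pinv A * A = cfc (fun x : ℝ => x * x⁻¹ * x) A := by
      rw [cfc_mul (fun x : ℝ => x * x⁻¹) (fun x : ℝ => x) A (hc _) (hc _), ← hid, h1]
    rw [h3]
    simp only [mul_inv_mul_cancel]
    exact hid.symm
  · have h3 : pinv A * A * pinv A = cfc (fun x : ℝ => x⁻¹ * x * x⁻¹) A := by
      rw [cfc_mul (fun x : ℝ => x⁻¹ * x) (fun x : ℝ => x⁻¹) A (hc _) (hc _), h2]; rfl
    rw [h3]
    have h4 : (fun x : ℝ => x⁻¹ * x * x⁻¹) = fun x : ℝ => x⁻¹ := by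
      funext x
      by_cases hx : x = 0 <;> simp [hx]
    rw [h4]
    rfl
  · rw [h1]
    exact cfc_predicate _ A
  · rw [h2]
    exact cfc_predicate _ A

open Classical in
/-- The quantum relative entropy `D(ρ‖σ)`: it is `Tr[ρ (log ρ - log σ)]` if `ρ ≪ σ`, and `∞`
otherwise. (For Hermitian arguments this trace is a real number.) -/
noncomputable def qrel {d : ℕ} (ρ σ : Op d) : EReal :=
  if SuppLE ρ σ then (((ρ * (opLog ρ - opLog σ)).trace.re : ℝ) : EReal) else ⊤

/-- The trace in the definition of the quantum relative entropy is real. -/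
theorem qrel_trace_im {d : ℕ} (ρ σ : Op d) (hρ : ρ.IsHermitian) :
    (ρ * (opLog ρ - opLog σ)).trace.im = 0 := by
  have h1 : (opLog ρ - opLog σ).IsHermitian :=
    Matrix.IsHermitian.sub (cfc_predicate _ ρ) (cfc_predicate _ σ)
  have h2 : star (ρ * (opLog ρ - opLog σ)).trace = (ρ * (opLog ρ - opLog σ)).trace := by
    rw [← Matrix.trace_conjTranspose, Matrix.conjTranspose_mul, h1.eq, hρ.eq, Matrix.trace_mul_comm]
  exact Complex.conj_eq_iff_im.mp h2

end QuantumStat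

/-! For each fixed `n` and outside a null set of `ω`, the four operators commute, so one unitary
diagonalises them all and the relative entropy becomes the classical sum `∑ p' (log p' - log q')`
over joint eigenvalues. Taylor expansion of each summand gives the result, once two obstacles are
removed.

At a zero eigenvalue of the limit there is no expansion, but the support conditions force the
summand and its approximation to vanish there. All other eigenvalues of `ρ`, and those of `σ` paired
with them, are at least some `m > 0` depending only on `ρ` and `σ`. The scalar expansions also
produce terms `p' - p` or `p' - q'`, which sum to zero because all traces equal one.

The eigenbasis varies with `n` and `ω`, so the bounds `exists_qrel_first_order` and
`exists_qrel_second_order` are stated without a basis: the remainder is controlled by traces of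
squares (`sqSize`), with constants depending only on the limit operators. No measurable choice of
eigenbasis is needed. The remainder is quadratic in (i) and cubic in (ii), so rescaling leaves a
factor `1 / r n` times a quantity that converges in distribution. The delta method
`tendstoInDistribution_of_abs_sub_le` then applies to a continuous linear or quadratic functional.
Reality of the limiting traces is a closed condition and passes to the limit. -/

namespace QuantumStat

/-! ### Simultaneous diagonalisation -/

/-- A family of pairwise commuting symmetric operators on a finite-dimensional inner product space
has an orthonormal basis of joint eigenvectors. -/
theorem exists_orthonormalBasis_joint_eigenvectors {𝕜 E ι : Type*} [RCLike 𝕜]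
    [NormedAddCommGroup E] [InnerProductSpace 𝕜 E] [FiniteDimensional 𝕜 E] {d : ℕ}
    (hd : Module.finrank 𝕜 E = d) {T : ι → E →ₗ[𝕜] E} (hT : ∀ i, (T i).IsSymmetric)
    (hC : Pairwise (Function.onFun Commute T)) :
    ∃ (b : OrthonormalBasis (Fin d) 𝕜 E) (c : ι → Fin d → 𝕜), ∀ i k, T i (b k) = c i k • b k := by
  classical
  have hV := LinearMap.IsSymmetric.directSum_isInternal_of_pairwise_commute hT hC
  have hV' := LinearMap.IsSymmetric.orthogonalFamily_iInf_eigenspaces hT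
  let v := fun α : ι → 𝕜 => stdOrthonormalBasis 𝕜
    (⨅ j, Module.End.eigenspace (T j) (α j) : Submodule 𝕜 E)
  let B := hV.collectedBasis fun α => (v α).toBasis
  have hB : Orthonormal 𝕜 B := by
    apply hV.collectedBasis_orthonormal hV'
    intro α
    simp
  let e : _ ≃ Fin d := B.indexEquiv ((Module.finBasis 𝕜 E).reindex (finCongr hd))
  let : Fintype _ := Fintype.ofEquiv _ e.symm
  let b := (B.toOrthonormalBasis hB).reindex e
  refine ⟨b, fun i k => (e.symm k).1 i, fun i k => ?_⟩
  have h1 : b k = B (e.symm k) := by simp [b]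
  have h2 : B (e.symm k) ∈ (⨅ j, Module.End.eigenspace (T j) ((e.symm k).1 j) : Submodule 𝕜 E) :=
    hV.collectedBasis_mem _ _
  rw [h1]
  exact Module.End.mem_eigenspace_iff.mp ((Submodule.mem_iInf _).mp h2 i)

/-- Pairwise commuting Hermitian matrices lie in the image of the diagonal matrices under one
unitary conjugation, with real diagonals. -/
theorem exists_unitary_joint_diagonal {d : ℕ} {ι : Type*} {A : ι → Op d}
    (hA : ∀ i, (A i).IsHermitian) (hC : Pairwise (Function.onFun Commute A)) :
    ∃ (U : Matrix.unitaryGroup (Fin d) ℂ) (a : ι → Fin d → ℝ),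
      ∀ i, A i = U * Matrix.diagonal (fun k => (a i k : ℂ)) * star (U : Op d) := by
  have hT : ∀ i, (Matrix.toEuclideanLin (A i)).IsSymmetric := fun i =>
    Matrix.isSymmetric_toEuclideanLin_iff.mpr (hA i)
  have hTC : Pairwise (Function.onFun Commute fun i => Matrix.toEuclideanLin (A i)) := by
    intro i j hij
    have h := hC hij
    refine LinearMap.ext fun x => ?_
    have h1 : (A i * A j).mulVec x.ofLp = (A j * A i).mulVec x.ofLp := by rw [h.eq]
    simp only [← Matrix.mulVec_mulVec] at h1
    simp [Matrix.toLpLin_apply, h1]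
  obtain ⟨b, c, hbc⟩ := exists_orthonormalBasis_joint_eigenvectors (d := d) (by simp) hT hTC
  let V : Op d := (EuclideanSpace.basisFun (Fin d) ℂ).toBasis.toMatrix b
  have hV : V ∈ Matrix.unitaryGroup (Fin d) ℂ :=
    (EuclideanSpace.basisFun (Fin d) ℂ).toMatrix_orthonormalBasis_mem_unitary b
  have hAV : ∀ i, A i * V = V * Matrix.diagonal (c i) := by
    intro i
    ext l k
    have h := congrArg (fun x : EuclideanSpace ℂ (Fin d) => x l) (hbc i k)
    simp only [Matrix.toLpLin_apply, PiLp.smul_apply, smul_eq_mul] at h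
    rw [Matrix.mul_diagonal, Matrix.mul_apply]
    simpa [V, Module.Basis.toMatrix_apply, Matrix.mulVec, dotProduct, mul_comm] using h
  have hD : ∀ i, Matrix.diagonal (c i) = star V * A i * V := by
    intro i
    rw [mul_assoc, hAV, ← mul_assoc, Unitary.star_mul_self_of_mem hV, one_mul]
  refine ⟨⟨V, hV⟩, fun i k => (c i k).re, fun i => ?_⟩
  have hc : (fun k => (((c i k).re : ℝ) : ℂ)) = c i := by
    -- The eigenvalues are real because this diagonal matrix is unitarily conjugate to a Hermitian
    -- one.
    have h1 : (Matrix.diagonal (c i)).IsHermitian := by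
      rw [hD i, Matrix.star_eq_conjTranspose]
      exact Matrix.isHermitian_conjTranspose_mul_mul V (hA i)
    funext k
    have h2 := h1.apply k k
    simp only [Matrix.diagonal_apply_eq] at h2
    exact Complex.conj_eq_iff_re.mp h2
  rw [hc, ← hAV, mul_assoc, Unitary.mul_star_self_of_mem hV, mul_one]

/-! ### Functional calculus in a fixed eigenbasis -/

/-- The diagonal matrices, conjugated by a unitary matrix. -/
noncomputable def conjDiagonal {d : ℕ} (U : Matrix.unitaryGroup (Fin d) ℂ) :
    (Fin d → ℂ) →⋆ₐ[ℂ] Op d where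
  toFun v := Unitary.conjStarAlgAut ℂ (Op d) U (Matrix.diagonal v)
  map_one' := by simp
  map_mul' v w := by rw [← map_mul, Matrix.diagonal_mul_diagonal']; rfl
  map_zero' := by simp
  map_add' v w := by rw [← map_add, Matrix.diagonal_add]; rfl
  commutes' z := by
    rw [← Matrix.algebraMap_eq_diagonal]
    exact AlgHomClass.commutes (Unitary.conjStarAlgAut ℂ (Op d) U) z
  map_star' v := by
    rw [← map_star, Matrix.star_eq_conjTranspose, Matrix.diagonal_conjTranspose]

theorem trace_conjDiagonal {d : ℕ} (U : Matrix.unitaryGroup (Fin d) ℂ) (v : Fin d → ℂ) :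
    (conjDiagonal U v).trace = ∑ k, v k := by
  change ((U : Op d) * Matrix.diagonal v * star (U : Op d)).trace = _
  rw [Matrix.trace_mul_cycle]
  simp

theorem continuous_conjDiagonal {d : ℕ} (U : Matrix.unitaryGroup (Fin d) ℂ) :
    Continuous (conjDiagonal U) := by
  change Continuous fun v => (U : Op d) * Matrix.diagonal v * star (U : Op d)
  fun_prop

/-- Only the finitely many values `a k` matter, so `f` can be replaced by its Lagrange interpolant,
and polynomials commute with algebra homomorphisms. No continuity of `f` is needed, which admits the
logarithm and the inverse with their value 0 at 0. -/
theorem cfc_conjDiagonal {d : ℕ} (U : Matrix.unitaryGroup (Fin d) ℂ) (f : ℝ → ℝ)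
    (a : Fin d → ℝ) :
    cfc f (conjDiagonal U fun k => (a k : ℂ)) = conjDiagonal U fun k => (f (a k) : ℂ) := by
  let a' : Fin d → ℂ := fun k => (a k : ℂ)
  have ha : IsSelfAdjoint a' := funext fun k => Complex.conj_ofReal (a k)
  have hs : ∀ k, spectrum ℝ (a' k) = {a k} := fun k => by
    have := spectrum.scalar_eq (𝕜 := ℝ) (A := ℂ) (a k)
    simpa [a'] using this
  have hsub : spectrum ℝ (conjDiagonal U a') ⊆ Set.range a := by
    refine (AlgHom.spectrum_apply_subset ((conjDiagonal U).restrictScalars ℝ) a').trans ?_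
    rw [Pi.spectrum_eq]
    exact Set.iUnion_subset fun k => by rw [hs k]; exact Set.singleton_subset_iff.mpr ⟨k, rfl⟩
  let q := Lagrange.interpolate (Finset.univ.image a) id f
  have hq : ∀ k, q.eval (a k) = f (a k) := fun k =>
    Lagrange.eval_interpolate_at_node f Function.injective_id.injOn
      (Finset.mem_image_of_mem a (Finset.mem_univ k))
  have h1 : cfc f (conjDiagonal U a') = cfc q.eval (conjDiagonal U a') := by
    refine cfc_congr fun x hx => ?_
    obtain ⟨k, rfl⟩ := hsub hx
    exact (hq k).symm
  have h2 : Polynomial.aeval a' q = fun k => (f (a k) : ℂ) := by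
    funext k
    have h := Polynomial.aeval_algHom_apply (Pi.evalAlgHom ℝ (fun _ : Fin d => ℂ) k) a' q
    rw [← hq k]
    refine h.symm.trans ?_
    exact Polynomial.aeval_algebraMap_apply ℂ (a k) q
  have hsa : IsSelfAdjoint (conjDiagonal U a') := ha.map (conjDiagonal U)
  change cfc f (conjDiagonal U a') = _
  rw [h1, cfc_polynomial q _ hsa, ← h2]
  exact Polynomial.aeval_algHom_apply ((conjDiagonal U).restrictScalars ℝ).toAlgHom a' q

/-! ### Scalar Taylor estimates -/

theorem abs_log_one_add_sub_le {t : ℝ} (ht : |t| ≤ 1 / 2) : |Real.log (1 + t) - t| ≤ 2 * t ^ 2 := by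
  have h := Real.abs_log_sub_add_sum_range_le (x := -t) (by rw [abs_neg]; linarith) 1
  simp only [Finset.sum_range_one, abs_neg, sub_neg_eq_add] at h
  norm_num at h
  have h2 : |t| ^ 2 / (1 - |t|) ≤ 2 * t ^ 2 := by
    rw [div_le_iff₀ (by linarith), sq_abs]
    nlinarith [sq_nonneg t]
  rw [show Real.log (1 + t) - t = -t + Real.log (1 + t) by ring]
  simp only [sq_abs] at h h2
  linarith

theorem abs_one_add_mul_log_sub_le {t : ℝ} (ht : |t| ≤ 1 / 2) :
    |(1 + t) * Real.log (1 + t) - t - t ^ 2 / 2| ≤ 7 / 2 * |t| ^ 3 := by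
  have h := Real.abs_log_sub_add_sum_range_le (x := -t) (by rw [abs_neg]; linarith) 2
  simp only [Finset.sum_range_succ, Finset.sum_range_zero, abs_neg, sub_neg_eq_add] at h
  norm_num at h
  set e := -t + t ^ 2 / 2 + Real.log (1 + t) with he
  have h2 : |e| ≤ 2 * |t| ^ 3 := by
    refine h.trans ?_
    rw [div_le_iff₀ (by linarith)]
    nlinarith [pow_nonneg (abs_nonneg t) 3]
  have h3 : (1 + t) * Real.log (1 + t) - t - t ^ 2 / 2 = (1 + t) * e - t ^ 3 / 2 := by
    rw [he]; ring
  rw [h3]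
  have h4 : |(1 + t) * e| ≤ 3 / 2 * (2 * |t| ^ 3) := by
    rw [abs_mul]
    refine mul_le_mul ?_ h2 (abs_nonneg _) (by norm_num)
    have := abs_le.mp ht
    exact abs_le.mpr ⟨by linarith, by linarith⟩
  have h5 : |t ^ 3 / 2| = |t| ^ 3 / 2 := by rw [abs_div, abs_pow]; norm_num
  have := abs_sub ((1 + t) * e) (t ^ 3 / 2)
  linarith

/-- First-order expansion of `x (log x - log y)` with a quadratic remainder. -/
theorem abs_mul_log_sub_log_first_order {m p q p' q' : ℝ} (hm : 0 < m) (hp : m ≤ p) (hp1 : p ≤ 1)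
    (hq : m ≤ q) (hp' : |p' - p| ≤ m / 2) (hq' : |q' - q| ≤ m / 2) :
    |p' * (Real.log p' - Real.log q') - p * (Real.log p - Real.log q) - (p' - p)
      - ((p' - p) * (Real.log p - Real.log q) - (q' - q) * p * q⁻¹)|
      ≤ 5 / m ^ 2 * ((p' - p) ^ 2 + (q' - q) ^ 2) := by
  have hp0 : 0 < p := by linarith
  have hq0 : 0 < q := by linarith
  -- Passing to relative increments `s`, `t` turns the logarithms into `log (1 + s)` and `log (1 +
  -- t)`, both with argument increment at most 1/2.
  obtain ⟨s, hs⟩ : ∃ s, p' - p = p * s := ⟨(p' - p) / p, by field_simp⟩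
  obtain ⟨t, ht⟩ : ∃ t, q' - q = q * t := ⟨(q' - q) / q, by field_simp⟩
  have hs2 : |s| ≤ 1 / 2 := by
    rw [hs, abs_mul, abs_of_pos hp0] at hp'
    by_contra! h
    nlinarith
  have ht2 : |t| ≤ 1 / 2 := by
    rw [ht, abs_mul, abs_of_pos hq0] at hq'
    by_contra! h
    nlinarith
  have hs3 := abs_le.mp hs2
  have ht3 := abs_le.mp ht2
  have e1 := abs_le.mp (abs_log_one_add_sub_le hs2)
  have e2 := abs_le.mp (abs_log_one_add_sub_le ht2)
  have l1 : Real.log p' = Real.log p + Real.log (1 + s) := by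
    rw [← Real.log_mul hp0.ne' (by linarith), show p' = p * (1 + s) by linarith]
  have l2 : Real.log q' = Real.log q + Real.log (1 + t) := by
    rw [← Real.log_mul hq0.ne' (by linarith), show q' = q * (1 + t) by linarith]
  have key : p' * (Real.log p' - Real.log q') - p * (Real.log p - Real.log q) - (p' - p)
      - ((p' - p) * (Real.log p - Real.log q) - (q' - q) * p * q⁻¹)
      = p * (s ^ 2 - s * t + (1 + s) * ((Real.log (1 + s) - s) - (Real.log (1 + t) - t))) := by
    rw [l1, l2, hs, ht, show p' = p * (1 + s) by linarith]
    field_simp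
    ring
  rw [key, abs_mul, abs_of_pos hp0]
  -- The 5 comes from `|s ^ 2 - s * t| ≤ 2 * (s ^ 2 + t ^ 2)` plus `3 / 2 * 2 * (s ^ 2 + t ^ 2)` for
  -- the two logarithm remainders.
  have hb : |s ^ 2 - s * t + (1 + s) * ((Real.log (1 + s) - s) - (Real.log (1 + t) - t))|
      ≤ 5 * (s ^ 2 + t ^ 2) := by
    generalize Real.log (1 + s) - s = x at e1 ⊢
    generalize Real.log (1 + t) - t = y at e2 ⊢
    have hxy : |x - y| ≤ 2 * s ^ 2 + 2 * t ^ 2 := abs_le.mpr ⟨by linarith, by linarith⟩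
    have h1 : |(1 + s) * (x - y)| ≤ 3 / 2 * (2 * s ^ 2 + 2 * t ^ 2) := by
      rw [abs_mul]
      exact mul_le_mul (abs_le.mpr ⟨by linarith, by linarith⟩) hxy (abs_nonneg _) (by norm_num)
    have h1' := abs_le.mp h1
    refine abs_le.mpr ⟨?_, ?_⟩ <;>
      nlinarith [sq_nonneg (s - t), sq_nonneg (s + t), sq_nonneg s, sq_nonneg t]
  have h1 : m ^ 2 * s ^ 2 ≤ (p' - p) ^ 2 := by
    rw [hs, mul_pow]; gcongr
  have h2 : m ^ 2 * t ^ 2 ≤ (q' - q) ^ 2 := by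
    rw [ht, mul_pow]; gcongr
  calc p * _ ≤ 1 * (5 * (s ^ 2 + t ^ 2)) := mul_le_mul hp1 hb (abs_nonneg _) zero_le_one
    _ = 5 / m ^ 2 * (m ^ 2 * s ^ 2 + m ^ 2 * t ^ 2) := by field_simp
    _ ≤ _ := by gcongr

/-- Second-order expansion of `x (log x - log y)` around the diagonal, with a cubic remainder. -/
theorem abs_mul_log_sub_log_second_order {m p p' q' : ℝ} (hm : 0 < m) (hp : m ≤ p)
    (hp' : |p' - p| ≤ m / 8) (hq' : |q' - p| ≤ m / 8) :
    |p' * (Real.log p' - Real.log q') - (p' - q') - 1 / 2 * ((p' - q') ^ 2 * p⁻¹)|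
      ≤ 6 / m ^ 2 * (|p' - p| + |q' - p|) ^ 3 := by
  have hp0 : 0 < p := by linarith
  have hq1 : 7 / 8 * m ≤ q' := by linarith [(abs_le.mp hq').1]
  have hq0 : 0 < q' := by linarith
  have hD : |p' - q'| ≤ |p' - p| + |q' - p| := by
    rw [show p' - q' = (p' - p) - (q' - p) by ring]; exact abs_sub _ _
  obtain ⟨t, ht⟩ : ∃ t, p' - q' = q' * t := ⟨(p' - q') / q', by field_simp⟩
  have habs : |p' - q'| = q' * |t| := by rw [ht, abs_mul, abs_of_pos hq0]
  have ht2 : |t| ≤ 1 / 2 := by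
    by_contra! h
    nlinarith
  have ht3 := abs_le.mp ht2
  have l1 : Real.log p' = Real.log q' + Real.log (1 + t) := by
    rw [← Real.log_mul hq0.ne' (by linarith), show p' = q' * (1 + t) by linarith]
  -- Expanding around `q'` gives the quadratic term with denominator `q'`; the last summand is the
  -- cost of replacing it by `p`, and is itself cubic.
  have key : p' * (Real.log p' - Real.log q') - (p' - q') - 1 / 2 * ((p' - q') ^ 2 * p⁻¹)
      = q' * ((1 + t) * Real.log (1 + t) - t - t ^ 2 / 2)
        + 1 / 2 * (q' * t) ^ 2 * (p - q') / (p * q') := by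
    rw [l1, ht, show p' = q' * (1 + t) by linarith]
    field_simp
    ring
  rw [key]
  set u := |p' - p| + |q' - p| with hu
  have hu0 : 0 ≤ u := by positivity
  have hw : q' * |t| ≤ u := habs ▸ hD
  have hw0 : 0 ≤ q' * |t| := by positivity
  have b1 : |q' * ((1 + t) * Real.log (1 + t) - t - t ^ 2 / 2)| ≤ 5 / m ^ 2 * u ^ 3 := by
    rw [abs_mul, abs_of_pos hq0]
    calc q' * _ ≤ q' * (7 / 2 * |t| ^ 3) := by gcongr; exact abs_one_add_mul_log_sub_le ht2
      _ = 7 / 2 / q' ^ 2 * (q' * |t|) ^ 3 := by field_simp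
      _ ≤ 7 / 2 / (7 / 8 * m) ^ 2 * u ^ 3 := by gcongr
      _ ≤ 5 / m ^ 2 * u ^ 3 := by
        gcongr ?_ * _
        rw [div_le_div_iff₀ (by positivity) (by positivity)]
        nlinarith [sq_nonneg m]
  have b2 : |1 / 2 * (q' * t) ^ 2 * (p - q') / (p * q')| ≤ 1 / m ^ 2 * u ^ 3 := by
    rw [abs_div, abs_mul, abs_of_pos (mul_pos hp0 hq0), abs_of_nonneg (by positivity)]
    have h3 : |p - q'| ≤ u := by rw [abs_sub_comm, hu]; linarith [abs_nonneg (p' - p)]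
    have h4 : (q' * t) ^ 2 ≤ u ^ 2 := by
      rw [← sq_abs, abs_mul, abs_of_pos hq0]; gcongr
    calc _ ≤ 1 / 2 * u ^ 2 * u / (m * (7 / 8 * m)) := by gcongr
      _ = 4 / 7 / m ^ 2 * u ^ 3 := by field_simp; ring
      _ ≤ _ := by gcongr; norm_num
  calc _ ≤ _ := abs_add_le _ _
    _ ≤ 5 / m ^ 2 * u ^ 3 + 1 / m ^ 2 * u ^ 3 := add_le_add b1 b2
    _ = _ := by ring

/-! ### Supports, spectra and relative entropy in a joint eigenbasis -/

variable {d : ℕ}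

/-- Taking orthogonal complements turns support inclusion into the reverse kernel inclusion, applied
here to each column of `X`. -/
theorem SuppLE.mul_eq_zero {A B X : Op d} (h : SuppLE A B) (hB : B * X = 0) : A * X = 0 := by
  have hker : LinearMap.ker (Matrix.toEuclideanLin B) ≤ LinearMap.ker (Matrix.toEuclideanLin A) := by
    have := Submodule.orthogonal_le h
    simpa only [support, Submodule.orthogonal_orthogonal] using this
  ext i k
  have hk : WithLp.toLp 2 (fun j => X j k) ∈ LinearMap.ker (Matrix.toEuclideanLin B) := by
    rw [LinearMap.mem_ker]
    ext l
    simpa [Matrix.toLpLin_apply, Matrix.mulVec, dotProduct, Matrix.mul_apply] using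
      congrFun (congrFun hB l) k
  have h2 := congrArg (fun x : EuclideanSpace ℂ (Fin d) => x i) (LinearMap.mem_ker.mp (hker hk))
  simpa [Matrix.toLpLin_apply, Matrix.mulVec, dotProduct, Matrix.mul_apply] using h2

variable (U : Matrix.unitaryGroup (Fin d) ℂ)

/-- The operator with real eigenvalues `a` in the eigenbasis given by the columns of `U`. -/
noncomputable def realDiagonal (a : Fin d → ℝ) : Op d :=
  conjDiagonal U fun k => (a k : ℂ)

theorem realDiagonal_mul (a b : Fin d → ℝ) :
    realDiagonal U a * realDiagonal U b = realDiagonal U fun k => a k * b k := by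
  rw [realDiagonal, realDiagonal, ← map_mul, realDiagonal]
  congr 1
  funext k
  simp

theorem realDiagonal_sub (a b : Fin d → ℝ) :
    realDiagonal U a - realDiagonal U b = realDiagonal U fun k => a k - b k := by
  rw [realDiagonal, realDiagonal, ← map_sub, realDiagonal]
  congr 1
  funext k
  simp

theorem trace_realDiagonal (a : Fin d → ℝ) :
    (realDiagonal U a).trace = ((∑ k, a k : ℝ) : ℂ) := by
  rw [realDiagonal, trace_conjDiagonal, Complex.ofReal_sum]

theorem trace_re_realDiagonal (a : Fin d → ℝ) : (realDiagonal U a).trace.re = ∑ k, a k := by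
  rw [trace_realDiagonal, Complex.ofReal_re]

theorem opLog_realDiagonal (a : Fin d → ℝ) :
    opLog (realDiagonal U a) = realDiagonal U fun k => Real.log (a k) :=
  cfc_conjDiagonal U Real.log a

theorem pinv_realDiagonal (a : Fin d → ℝ) :
    pinv (realDiagonal U a) = realDiagonal U fun k => (a k)⁻¹ :=
  cfc_conjDiagonal U _ a

theorem isHermitian_realDiagonal (a : Fin d → ℝ) : (realDiagonal U a).IsHermitian := by
  rw [Matrix.IsHermitian, ← Matrix.star_eq_conjTranspose, realDiagonal, ← map_star]
  congr 1
  funext j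
  exact Complex.conj_ofReal _

/-- The trace against the `k`-th rank-one spectral projection reads off the `k`-th eigenvalue. -/
theorem realDiagonal_injective : Function.Injective (realDiagonal U) := by
  intro a b h
  funext k
  have h1 := congrArg (fun X => (X * realDiagonal U (Pi.single k 1)).trace.re) h
  simpa [realDiagonal_mul, trace_re_realDiagonal, Pi.single_apply] using h1

theorem realDiagonal_zero : realDiagonal U 0 = 0 := by
  have h := realDiagonal_sub U 0 0
  simp only [sub_self, Pi.zero_apply] at h
  exact h.symm

theorem SuppLE.eq_zero {a b : Fin d → ℝ} (h : SuppLE (realDiagonal U a) (realDiagonal U b))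
    {k : Fin d} (hb : b k = 0) : a k = 0 := by
  have h1 : realDiagonal U b * realDiagonal U (Pi.single k 1) = 0 := by
    rw [realDiagonal_mul, ← realDiagonal_zero U]
    congr 1
    funext j
    by_cases hj : j = k
    · subst hj; simp [hb]
    · simp [hj]
  have h2 := h.mul_eq_zero h1
  rw [realDiagonal_mul, ← realDiagonal_zero U] at h2
  simpa using congrFun (realDiagonal_injective U h2) k

theorem nonneg_of_posSemidef_realDiagonal {a : Fin d → ℝ} (h : (realDiagonal U a).PosSemidef)
    (k : Fin d) : 0 ≤ a k := by
  have h1 := (h.conjTranspose_mul_mul_same (realDiagonal U (Pi.single k 1))).trace_nonneg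
  rw [(isHermitian_realDiagonal U _).eq, realDiagonal_mul, realDiagonal_mul,
    trace_realDiagonal] at h1
  have h2 := Complex.zero_le_real.mp h1
  simpa [Pi.single_apply] using h2

/-- The shifted operator annihilates the nonzero `k`-th projection, so it is not a unit. -/
theorem mem_spectrum_realDiagonal (a : Fin d → ℝ) (k : Fin d) :
    a k ∈ spectrum ℝ (realDiagonal U a) := by
  rw [spectrum.mem_iff]
  intro hu
  have h1 : algebraMap ℝ (Op d) (a k) = realDiagonal U fun _ => a k :=
    (((conjDiagonal U).restrictScalars ℝ).toAlgHom.commutes (a k)).symm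
  rw [h1, realDiagonal_sub] at hu
  have h2 : (realDiagonal U fun j => a k - a j) * realDiagonal U (Pi.single k 1) = 0 := by
    rw [realDiagonal_mul, ← realDiagonal_zero U]
    congr 1
    funext j
    by_cases hj : j = k
    · subst hj; simp
    · simp [hj]
  have h3 := (hu.mul_right_eq_zero).mp h2
  rw [← realDiagonal_zero U] at h3
  simpa using congrFun (realDiagonal_injective U h3) k

theorem toReal_qrel {ρ σ : Op d} (h : SuppLE ρ σ) :
    (qrel ρ σ).toReal = (ρ * (opLog ρ - opLog σ)).trace.re := by
  rw [qrel, if_pos h, EReal.toReal_coe]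

theorem qrel_ne_top {ρ σ : Op d} (h : SuppLE ρ σ) : qrel ρ σ ≠ ⊤ := by
  rw [qrel, if_pos h]; exact EReal.coe_ne_top _

theorem toReal_qrel_realDiagonal {p q : Fin d → ℝ}
    (h : SuppLE (realDiagonal U p) (realDiagonal U q)) :
    (qrel (realDiagonal U p) (realDiagonal U q)).toReal
      = ∑ k, p k * (Real.log (p k) - Real.log (q k)) := by
  rw [toReal_qrel h, opLog_realDiagonal, opLog_realDiagonal, realDiagonal_sub, realDiagonal_mul,
    trace_re_realDiagonal]

/-- The nonzero eigenvalues of a matrix are bounded away from zero. -/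
theorem exists_pos_le_of_mem_spectrum (A : Op d) :
    ∃ m > 0, ∀ x ∈ spectrum ℝ A, 0 < x → m ≤ x := by
  have hf : (spectrum ℝ A ∩ Set.Ioi 0).Finite := Matrix.finite_real_spectrum.inter_of_left _
  obtain h | h := (spectrum ℝ A ∩ Set.Ioi 0).eq_empty_or_nonempty
  · exact ⟨1, one_pos, fun x hx hx0 => absurd (h ▸ ⟨hx, hx0⟩ : x ∈ (∅ : Set ℝ)) (by simp)⟩
  · obtain ⟨m, hm, hmin⟩ := Set.exists_min_image _ id hf h
    exact ⟨m, hm.2, fun x hx hx0 => hmin x ⟨hx, hx0⟩⟩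

theorem exists_realDiagonal_quadruple {ρ σ ρ' σ' : Op d} (hρ : ρ.IsHermitian) (hσ : σ.IsHermitian)
    (hρ' : ρ'.IsHermitian) (hσ' : σ'.IsHermitian) (h1 : Commute ρ σ) (h2 : Commute ρ' σ')
    (h3 : Commute ρ' ρ) (h4 : Commute ρ' σ) (h5 : Commute σ' ρ) (h6 : Commute σ' σ) :
    ∃ (U : Matrix.unitaryGroup (Fin d) ℂ) (p q p' q' : Fin d → ℝ), ρ = realDiagonal U p ∧
      σ = realDiagonal U q ∧ ρ' = realDiagonal U p' ∧ σ' = realDiagonal U q' := by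
  obtain ⟨U, a, ha⟩ := exists_unitary_joint_diagonal (A := ![ρ, σ, ρ', σ'])
    (by intro i; fin_cases i <;> assumption)
    (by
      intro i j hij
      have := h1.symm; have := h2.symm; have := h3.symm
      have := h4.symm; have := h5.symm; have := h6.symm
      fin_cases i <;> fin_cases j <;> first | exact absurd rfl hij | assumption)
  exact ⟨U, a 0, a 1, a 2, a 3, ha 0, ha 1, ha 2, ha 3⟩

/-! ### Deterministic expansions with uniform remainder -/

/-- The squared Hilbert-Schmidt size of a pair of Hermitian operators. -/
noncomputable def sqSize (x : Op d × Op d) : ℝ := (x.1 ^ 2).trace.re + (x.2 ^ 2).trace.re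

theorem sqSize_realDiagonal (p q p' q' : Fin d → ℝ) :
    sqSize (realDiagonal U p' - realDiagonal U p, realDiagonal U q' - realDiagonal U q)
      = ∑ k, ((p' k - p k) ^ 2 + (q' k - q k) ^ 2) := by
  simp only [sqSize, pow_two, realDiagonal_sub, realDiagonal_mul, trace_re_realDiagonal,
    Finset.sum_add_distrib]

/-- First-order expansion of the relative entropy along commuting operators. -/
theorem exists_qrel_first_order {ρ σ : Op d} (hρ : IsDensityOperator ρ) (hσ : IsDensityOperator σ)
    (hρσ : SuppLE ρ σ) (hc : Commute ρ σ) :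
    ∃ C ≥ 0, ∃ δ > 0, ∀ ρ' σ' : Op d, IsDensityOperator ρ' → IsDensityOperator σ' →
      SuppLE ρ' σ' → SuppLE ρ' ρ → Commute ρ' σ' → Commute ρ' ρ → Commute ρ' σ →
      Commute σ' ρ → Commute σ' σ → sqSize (ρ' - ρ, σ' - σ) ≤ δ →
      |(qrel ρ' σ').toReal - (qrel ρ σ).toReal
        - ((ρ' - ρ) * (opLog ρ - opLog σ) - (σ' - σ) * ρ * pinv σ).trace.re|
        ≤ C * sqSize (ρ' - ρ, σ' - σ) := by
  obtain ⟨m₁, hm₁, hs₁⟩ := exists_pos_le_of_mem_spectrum ρ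
  obtain ⟨m₂, hm₂, hs₂⟩ := exists_pos_le_of_mem_spectrum σ
  set m := min m₁ m₂ with hm_def
  have hm : 0 < m := lt_min hm₁ hm₂
  refine ⟨5 / m ^ 2, by positivity, (m / 2) ^ 2, by positivity, ?_⟩
  intro ρ' σ' hρ' hσ' hs hsρ c1 c2 c3 c4 c5 hN
  obtain ⟨U, p, q, p', q', rfl, rfl, rfl, rfl⟩ := exists_realDiagonal_quadruple hρ.1.1 hσ.1.1
    hρ'.1.1 hσ'.1.1 hc c1 c2 c3 c4 c5
  rw [sqSize_realDiagonal] at hN ⊢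
  have hp0 := nonneg_of_posSemidef_realDiagonal U hρ.1
  have hq0 := nonneg_of_posSemidef_realDiagonal U hσ.1
  have hp1 : ∑ k, p k = 1 := by rw [← trace_re_realDiagonal U, hρ.2, Complex.one_re]
  have hp'1 : ∑ k, p' k = 1 := by rw [← trace_re_realDiagonal U, hρ'.2, Complex.one_re]
  have hN' : ∀ k, (p' k - p k) ^ 2 + (q' k - q k) ^ 2 ≤ (m / 2) ^ 2 := fun k =>
    (Finset.single_le_sum (f := fun k => (p' k - p k) ^ 2 + (q' k - q k) ^ 2)
      (fun k _ => by positivity) (Finset.mem_univ k)).trans hN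
  -- The extra `p' k - p k` in each summand is free: both traces are one.
  have hsum : (qrel (realDiagonal U p') (realDiagonal U q')).toReal
      - (qrel (realDiagonal U p) (realDiagonal U q)).toReal
      - ((realDiagonal U p' - realDiagonal U p)
            * (opLog (realDiagonal U p) - opLog (realDiagonal U q))
          - (realDiagonal U q' - realDiagonal U q) * realDiagonal U p
            * pinv (realDiagonal U q)).trace.re
      = ∑ k, (p' k * (Real.log (p' k) - Real.log (q' k)) - p k * (Real.log (p k) - Real.log (q k))
        - (p' k - p k) - ((p' k - p k) * (Real.log (p k) - Real.log (q k))
          - (q' k - q k) * p k * (q k)⁻¹)) := by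
    simp only [toReal_qrel_realDiagonal U hs, toReal_qrel_realDiagonal U hρσ, opLog_realDiagonal,
      pinv_realDiagonal, realDiagonal_sub, realDiagonal_mul, trace_re_realDiagonal,
      Finset.sum_sub_distrib, hp1, hp'1, sub_self, sub_zero]
  rw [hsum, Finset.mul_sum]
  refine (Finset.abs_sum_le_sum_abs _ _).trans (Finset.sum_le_sum fun k _ => ?_)
  -- If `p k = 0` then `p' k = 0` by support inclusion and the whole summand vanishes, whatever `q
  -- k` and `q' k` are.
  obtain hpk | hpk := (hp0 k).eq_or_lt
  · rw [hsρ.eq_zero U hpk.symm, ← hpk]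
    simp only [zero_mul, mul_zero, sub_zero, abs_zero]
    positivity
  · have hqk : 0 < q k := (hq0 k).lt_of_ne fun h => hpk.ne' (hρσ.eq_zero U h.symm)
    have hpm : m ≤ p k := (min_le_left _ _).trans (hs₁ _ (mem_spectrum_realDiagonal U p k) hpk)
    have hqm : m ≤ q k := (min_le_right _ _).trans (hs₂ _ (mem_spectrum_realDiagonal U q k) hqk)
    have hpk1 : p k ≤ 1 := hp1 ▸ Finset.single_le_sum (fun k _ => hp0 k) (Finset.mem_univ k)
    refine abs_mul_log_sub_log_first_order hm hpm hpk1 hqm ?_ ?_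
    · exact abs_le_of_sq_le_sq (by nlinarith [hN' k, sq_nonneg (q' k - q k)]) (by positivity)
    · exact abs_le_of_sq_le_sq (by nlinarith [hN' k, sq_nonneg (p' k - p k)]) (by positivity)

/-- Second-order expansion of the relative entropy around equal arguments, along commuting
operators. -/
theorem exists_qrel_second_order {ρ : Op d} (hρ : IsDensityOperator ρ) :
    ∃ C ≥ 0, ∃ δ > 0, ∀ ρ' σ' : Op d, IsDensityOperator ρ' → IsDensityOperator σ' →
      SuppLE ρ' σ' → SuppLE σ' ρ → Commute ρ' σ' → Commute ρ' ρ →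
      Commute σ' ρ → sqSize (ρ' - ρ, σ' - ρ) ≤ δ →
      |(qrel ρ' σ').toReal - 1 / 2 * ((ρ' - ρ - (σ' - ρ)) ^ 2 * pinv ρ).trace.re|
        ≤ C * (sqSize (ρ' - ρ, σ' - ρ) * √(sqSize (ρ' - ρ, σ' - ρ))) := by
  obtain ⟨m, hm, hs₁⟩ := exists_pos_le_of_mem_spectrum ρ
  -- The 8 is the cube of 2 in `|p' k - p k| + |q' k - p k| ≤ 2 * √N`; each of the `d` coordinates
  -- is bounded by the full `N`.
  refine ⟨∑ _ : Fin d, 6 / m ^ 2 * 8, by positivity, (m / 8) ^ 2, by positivity, ?_⟩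
  intro ρ' σ' hρ' hσ' hs hsσ c1 c2 c4 hN
  obtain ⟨U, p, q, p', q', rfl, hq, rfl, rfl⟩ := exists_realDiagonal_quadruple hρ.1.1 hρ.1.1
    hρ'.1.1 hσ'.1.1 (Commute.refl ρ) c1 c2 c2 c4 c4
  rw [sqSize_realDiagonal] at hN ⊢
  have hp0 := nonneg_of_posSemidef_realDiagonal U hρ.1
  have hp'1 : ∑ k, p' k = 1 := by rw [← trace_re_realDiagonal U, hρ'.2, Complex.one_re]
  have hq'1 : ∑ k, q' k = 1 := by rw [← trace_re_realDiagonal U, hσ'.2, Complex.one_re]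
  set N := ∑ k, ((p' k - p k) ^ 2 + (q' k - p k) ^ 2) with hN_def
  have hN0 : 0 ≤ N := by positivity
  have hle : ∀ k, (p' k - p k) ^ 2 + (q' k - p k) ^ 2 ≤ N := fun k =>
    Finset.single_le_sum (f := fun k => (p' k - p k) ^ 2 + (q' k - p k) ^ 2)
      (fun k _ => by positivity) (Finset.mem_univ k)
  have hpN : ∀ k, |p' k - p k| ≤ √N := fun k =>
    Real.abs_le_sqrt (by linarith [hle k, sq_nonneg (q' k - p k)])
  have hqN : ∀ k, |q' k - p k| ≤ √N := fun k =>
    Real.abs_le_sqrt (by linarith [hle k, sq_nonneg (p' k - p k)])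
  have hsN : √N ≤ m / 8 := Real.sqrt_le_iff.mpr ⟨by positivity, hN⟩
  have hsum : (qrel (realDiagonal U p') (realDiagonal U q')).toReal
      - 1 / 2 * ((realDiagonal U p' - realDiagonal U p - (realDiagonal U q' - realDiagonal U p)) ^ 2
        * pinv (realDiagonal U p)).trace.re
      = ∑ k, (p' k * (Real.log (p' k) - Real.log (q' k)) - (p' k - q' k)
        - 1 / 2 * ((p' k - q' k) ^ 2 * (p k)⁻¹)) := by
    simp only [sub_sub_sub_cancel_right, pow_two, toReal_qrel_realDiagonal U hs,
      pinv_realDiagonal, realDiagonal_sub, realDiagonal_mul, trace_re_realDiagonal,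
      Finset.sum_sub_distrib, hp'1, hq'1, sub_self, sub_zero, Finset.mul_sum]
  rw [hsum, Finset.sum_mul]
  refine (Finset.abs_sum_le_sum_abs _ _).trans (Finset.sum_le_sum fun k _ => ?_)
  obtain hpk | hpk := (hp0 k).eq_or_lt
  -- Support inclusion passes the zero from `ρ` to `σ'` and then to `ρ'`.
  · have hq'k : q' k = 0 := hsσ.eq_zero U hpk.symm
    rw [hs.eq_zero U hq'k, hq'k, ← hpk]
    simp only [zero_mul, inv_zero, mul_zero, sub_zero, abs_zero]
    positivity
  · have hpm : m ≤ p k := hs₁ _ (mem_spectrum_realDiagonal U p k) hpk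
    refine (abs_mul_log_sub_log_second_order hm hpm ((hpN k).trans hsN)
      ((hqN k).trans hsN)).trans ?_
    have hu : |p' k - p k| + |q' k - p k| ≤ 2 * √N := by linarith [hpN k, hqN k]
    calc _ ≤ 6 / m ^ 2 * (2 * √N) ^ 3 := by gcongr
      _ = 6 / m ^ 2 * 8 * (√N ^ 2 * √N) := by ring
      _ = _ := by rw [Real.sq_sqrt hN0]

/-! ### Weak convergence and the delta method -/

section Probability

variable {Ω Ω' E : Type*} [MeasurableSpace Ω] [MeasurableSpace Ω']
  {P : Measure Ω} [IsProbabilityMeasure P] {P' : Measure Ω'} [IsProbabilityMeasure P']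
  [TopologicalSpace E] [MeasurableSpace E] [OpensMeasurableSpace E]

/-- Convergence in distribution to the constant `0` implies convergence in probability. -/
theorem tendstoInMeasure_zero_of_tendstoInDistribution {X : ℕ → Ω → ℝ}
    (h : TendstoInDistribution X atTop (fun _ => (0 : ℝ)) (fun _ => P) P') :
    TendstoInMeasure P X atTop (fun _ => (0 : ℝ)) := by
  rw [tendstoInMeasure_iff_norm]
  intro ε hε
  have hcl : IsClosed {x : ℝ | ε ≤ ‖x‖} := isClosed_le continuous_const continuous_norm
  have h1 := ProbabilityMeasure.limsup_measure_closed_le_of_tendsto h.tendsto hcl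
  have h2 : (P'.map fun _ => (0 : ℝ)) {x : ℝ | ε ≤ ‖x‖} = 0 := by
    rw [Measure.map_apply measurable_const hcl.measurableSet]
    simp [hε.not_ge]
  have h3 : ∀ n, (P.map (X n)) {x : ℝ | ε ≤ ‖x‖} = P {ω | ε ≤ ‖X n ω - 0‖} := fun n => by
    rw [Measure.map_apply_of_aemeasurable (h.forall_aemeasurable n) hcl.measurableSet]
    simp
  simp only [ProbabilityMeasure.coe_mk, h2, h3] at h1
  exact tendsto_of_le_liminf_of_limsup_le bot_le h1

/-- A sequence converging in distribution is `o_P(1)` after multiplication by a null sequence. -/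
theorem tendstoInMeasure_mul_zero {X : ℕ → Ω → ℝ} {Z : Ω' → ℝ} {a : ℕ → ℝ}
    (h : TendstoInDistribution X atTop Z (fun _ => P) P') (ha : Tendsto a atTop (𝓝 0)) :
    TendstoInMeasure P (fun n ω => a n * X n ω) atTop (fun _ => (0 : ℝ)) := by
  have ha' : TendstoInMeasure P (fun n (_ : Ω) => a n) atTop (fun _ => (0 : ℝ)) :=
    tendstoInMeasure_of_tendsto_ae (fun n => aestronglyMeasurable_const) (ae_of_all _ fun _ => ha)
  have h1 := h.continuous_comp_prodMk_of_tendstoInMeasure_const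
    (g := fun x : ℝ × ℝ => x.2 * x.1) (by fun_prop) ha' (fun n => aemeasurable_const)
  simp only [zero_mul] at h1
  exact tendstoInMeasure_zero_of_tendstoInDistribution h1

/-- The delta method: if `X n` agrees with `Φ (Z n)` up to an error that is at most `G (Z n) / r n`
whenever `S (Z n) / (r n)²` is small, then `X n` converges in distribution to `Φ Z`. -/
theorem tendstoInDistribution_of_abs_sub_le {Z : ℕ → Ω → E} {L : Ω' → E} {X : ℕ → Ω → ℝ}
    {Φ G S : E → ℝ} {r : ℕ → ℝ} {δ : ℝ}
    (hZ : TendstoInDistribution Z atTop L (fun _ => P) P') (hΦ : Continuous Φ) (hG : Continuous G)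
    (hS : Continuous S) (hr : Tendsto r atTop atTop) (hδ : 0 < δ)
    (hX : ∀ n, AEMeasurable (X n) P)
    (hle : ∀ n, ∀ᵐ ω ∂P, (r n)⁻¹ ^ 2 * S (Z n ω) ≤ δ →
      |X n ω - Φ (Z n ω)| ≤ (r n)⁻¹ * G (Z n ω)) :
    TendstoInDistribution X atTop (fun ω => Φ (L ω)) (fun _ => P) P' := by
  have hr0 : Tendsto (fun n => (r n)⁻¹) atTop (𝓝 0) := tendsto_inv_atTop_zero.comp hr
  have hr2 : Tendsto (fun n => (r n)⁻¹ ^ 2) atTop (𝓝 0) := by simpa using hr0.pow 2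
  have hGm := tendstoInMeasure_mul_zero (hZ.continuous_comp hG) hr0
  have hSm := tendstoInMeasure_mul_zero (hZ.continuous_comp hS) hr2
  refine tendstoInDistribution_of_tendstoInMeasure_sub X _ (hZ.continuous_comp hΦ) ?_ hX
  rw [tendstoInMeasure_iff_norm] at hGm hSm ⊢
  intro ε hε
  have hsum := (hSm δ hδ).add (hGm ε hε)
  rw [add_zero] at hsum
  -- An error of at least `ε` requires either that the smallness condition fails or that the
  -- rescaled bound reaches `ε`; both events have vanishing probability.
  refine tendsto_of_tendsto_of_tendsto_of_le_of_le tendsto_const_nhds hsum (fun _ => zero_le)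
    fun n => ?_
  refine (measure_mono_ae ?_).trans (measure_union_le _ _)
  filter_upwards [hle n] with ω hω h1
  change ε ≤ ‖X n ω - Φ (Z n ω) - 0‖ at h1
  rw [sub_zero, Real.norm_eq_abs] at h1
  by_cases hs : (r n)⁻¹ ^ 2 * S (Z n ω) ≤ δ
  · right
    change ε ≤ ‖(r n)⁻¹ * G (Z n ω) - 0‖
    rw [sub_zero]
    exact h1.trans ((hω hs).trans (le_abs_self _))
  · left
    change δ ≤ ‖(r n)⁻¹ ^ 2 * S (Z n ω) - 0‖
    rw [sub_zero]
    exact (not_le.mp hs).le.trans (le_abs_self _)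

/-- A closed condition that holds almost surely along a sequence converging in distribution holds
almost surely in the limit. -/
theorem ae_mem_of_tendstoInDistribution [HasOuterApproxClosed E] {Z : ℕ → Ω → E} {L : Ω' → E}
    {F : Set E} (hZ : TendstoInDistribution Z atTop L (fun _ => P) P') (hF : IsClosed F)
    (h : ∀ n, ∀ᵐ ω ∂P, Z n ω ∈ F) : ∀ᵐ ω ∂P', L ω ∈ F := by
  have h1 := ProbabilityMeasure.limsup_measure_closed_le_of_tendsto hZ.tendsto hF
  have h3 : ∀ n, (P.map (Z n)) F = 1 := fun n => by
    rw [Measure.map_apply_of_aemeasurable (hZ.forall_aemeasurable n) hF.measurableSet]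
    refine (prob_compl_eq_zero_iff₀ ((hZ.forall_aemeasurable n).nullMeasurable
      hF.measurableSet)).mp (ae_iff.mp (h n))
  simp only [ProbabilityMeasure.coe_mk, h3, limsup_const] at h1
  rw [Measure.map_apply_of_aemeasurable hZ.aemeasurable_limit hF.measurableSet] at h1
  exact ae_iff.mpr ((prob_compl_eq_zero_iff₀ (hZ.aemeasurable_limit.nullMeasurable
    hF.measurableSet)).mpr (le_antisymm prob_le_one h1))

end Probability

/-! ### Measurability of the relative entropy -/

/-- The operator logarithm is discontinuous where the rank changes, but it is a pointwise limit of
polynomials on density operators, whose spectra lie in `[0, 1]`. The polynomials uniformly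
approximate `x * log x` times `x / (x ^ 2 + 1 / (n + 1))`, which is continuous, tends to `log x` for
`x ≠ 0`, and is 0 at 0, matching the convention there. -/
theorem measurable_opLog_comp {d : ℕ} {Ω : Type*} [MeasurableSpace Ω] {A : Ω → Op d}
    (hA : Measurable A) (hρ : ∀ ω, IsDensityOperator (A ω)) : Measurable fun ω => opLog (A ω) := by
  have h1 : ∀ n : ℕ, ∃ q : Polynomial ℝ, ∀ x ∈ Set.Icc (0 : ℝ) 1,
      |q.eval x - Real.log x * x * (x / (x ^ 2 + ((n : ℝ) + 1)⁻¹))| < ((n : ℝ) + 1)⁻¹ := by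
    intro n
    refine exists_polynomial_near_of_continuousOn 0 1 _ (Continuous.continuousOn ?_) _
      (by positivity)
    refine Continuous.mul ?_ (Continuous.div₀ continuous_id (by fun_prop) fun x => by positivity)
    simpa only [mul_comm] using Real.continuous_mul_log
  choose q hq using h1
  have hlim : ∀ x ∈ Set.Icc (0 : ℝ) 1, Tendsto (fun n => (q n).eval x) atTop (𝓝 (Real.log x)) := by
    intro x hx
    have hinv : Tendsto (fun n : ℕ => ((n : ℝ) + 1)⁻¹) atTop (𝓝 0) := by
      simpa only [one_div] using tendsto_one_div_add_atTop_nhds_zero_nat (𝕜 := ℝ)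
    have h2 : Tendsto (fun n : ℕ => Real.log x * x * (x / (x ^ 2 + ((n : ℝ) + 1)⁻¹))) atTop
        (𝓝 (Real.log x)) := by
      obtain rfl | hx0 := eq_or_ne x 0
      · simp
      · have h3 := ((tendsto_const_nhds (x := x ^ 2)).add hinv)
        rw [add_zero] at h3
        have h4 := ((tendsto_const_nhds (x := x)).div h3 (pow_ne_zero 2 hx0)).const_mul
          (Real.log x * x)
        have h5 : Real.log x * x * (x / x ^ 2) = Real.log x := by field_simp
        rwa [h5] at h4
    have h6 : Tendsto (fun n : ℕ => (q n).eval x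
        - Real.log x * x * (x / (x ^ 2 + ((n : ℝ) + 1)⁻¹))) atTop (𝓝 0) :=
      squeeze_zero_norm (fun n => (hq n x hx).le) hinv
    simpa using h6.add h2
  have : TopologicalSpace.PseudoMetrizableSpace (Op d) :=
    inferInstanceAs (TopologicalSpace.PseudoMetrizableSpace (Fin d → Fin d → ℂ))
  refine measurable_of_tendsto_metrizable (f := fun n ω => Polynomial.aeval (A ω) (q n)) ?_ ?_
  · intro n
    exact (Polynomial.continuous_aeval (q n)).measurable.comp hA
  · rw [tendsto_pi_nhds]
    intro ω
    obtain ⟨U, a, ha⟩ := exists_unitary_joint_diagonal (A := fun _ : Unit => A ω)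
      (fun _ => (hρ ω).1.1) (fun i j h => absurd rfl h)
    replace ha : A ω = realDiagonal U (a ()) := ha ()
    have hpos := nonneg_of_posSemidef_realDiagonal U (ha ▸ (hρ ω).1)
    have hsum : ∑ k, a () k = 1 := by
      rw [← trace_re_realDiagonal U, ← ha, (hρ ω).2, Complex.one_re]
    have hle : ∀ k, a () k ≤ 1 := fun k =>
      hsum ▸ Finset.single_le_sum (fun k _ => hpos k) (Finset.mem_univ k)
    have h7 : ∀ n, Polynomial.aeval (A ω) (q n) = realDiagonal U fun k => (q n).eval (a () k) := by
      intro n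
      have hs : IsSelfAdjoint (A ω) := (hρ ω).1.1
      rw [← cfc_polynomial (q n) (A ω) hs, ha]
      exact cfc_conjDiagonal U _ _
    rw [ha, opLog_realDiagonal, ← ha]
    simp only [h7]
    refine ((continuous_conjDiagonal U).tendsto _).comp (tendsto_pi_nhds.mpr fun k => ?_)
    exact (Complex.continuous_ofReal.tendsto _).comp (hlim _ ⟨hpos k, hle k⟩)

theorem aemeasurable_toReal_qrel {d : ℕ} {Ω : Type*} [MeasurableSpace Ω] {P : Measure Ω}
    {A B : Ω → Op d} (hA : Measurable A) (hB : Measurable B) (hAρ : ∀ ω, IsDensityOperator (A ω))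
    (hBρ : ∀ ω, IsDensityOperator (B ω)) (h : ∀ᵐ ω ∂P, SuppLE (A ω) (B ω)) :
    AEMeasurable (fun ω => (qrel (A ω) (B ω)).toReal) P := by
  have h1 : Measurable fun ω => (A ω * (opLog (A ω) - opLog (B ω))).trace.re := by
    have hc : Continuous fun x : Op d => x.trace.re := by fun_prop
    exact hc.measurable.comp
      (hA.mul ((measurable_opLog_comp hA hAρ).sub (measurable_opLog_comp hB hBρ)))
  refine h1.aemeasurable.congr ?_
  filter_upwards [h] with ω hω
  exact (toReal_qrel hω).symm

/-! ### Reality, homogeneity and continuity of the limit functionals -/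

theorem trace_mul_im_eq_zero {d : ℕ} {A B : Op d} (hA : A.IsHermitian) (hB : B.IsHermitian) :
    (A * B).trace.im = 0 := by
  refine Complex.conj_eq_iff_im.mp ?_
  change star (A * B).trace = _
  rw [← Matrix.trace_conjTranspose, Matrix.conjTranspose_mul, hA.eq, hB.eq, Matrix.trace_mul_comm]

theorem isHermitian_mul_pinv {d : ℕ} {ρ σ : Op d} (hρ : ρ.IsHermitian) (hσ : σ.IsHermitian)
    (hc : Commute ρ σ) : (ρ * pinv σ).IsHermitian := by
  obtain ⟨U, p, q, -, -, rfl, rfl, -, -⟩ := exists_realDiagonal_quadruple hρ hσ hρ hσ hc hc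
    (Commute.refl ρ) hc hc.symm (Commute.refl σ)
  rw [pinv_realDiagonal, realDiagonal_mul]
  exact isHermitian_realDiagonal U _

theorem sqSize_smul {d : ℕ} (c : ℝ) (x : Op d × Op d) : sqSize (c • x) = c ^ 2 * sqSize x := by
  simp only [sqSize, Prod.smul_fst, Prod.smul_snd, smul_pow, Matrix.trace_smul, Complex.smul_re,
    smul_eq_mul, mul_add]

theorem continuous_sqSize {d : ℕ} : Continuous (sqSize (d := d)) := by
  unfold sqSize
  fun_prop

/-- The derivative of the relative entropy at `(ρ, σ)`, along commuting operators. -/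
noncomputable def qrelDeriv {d : ℕ} (ρ σ : Op d) (x : Op d × Op d) : ℂ :=
  (x.1 * (opLog ρ - opLog σ) - x.2 * ρ * pinv σ).trace

theorem qrelDeriv_smul {d : ℕ} (ρ σ : Op d) (c : ℝ) (x : Op d × Op d) :
    qrelDeriv ρ σ (c • x) = c • qrelDeriv ρ σ x := by
  simp only [qrelDeriv, Prod.smul_fst, Prod.smul_snd, smul_mul_assoc, ← smul_sub,
    Matrix.trace_smul]

theorem continuous_qrelDeriv {d : ℕ} (ρ σ : Op d) : Continuous (qrelDeriv ρ σ) := by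
  unfold qrelDeriv
  fun_prop

theorem qrelDeriv_im {d : ℕ} {ρ σ : Op d} (hρ : ρ.IsHermitian) (hσ : σ.IsHermitian)
    (hc : Commute ρ σ) {x : Op d × Op d} (h1 : x.1.IsHermitian) (h2 : x.2.IsHermitian) :
    (qrelDeriv ρ σ x).im = 0 := by
  have hl : (opLog ρ - opLog σ).IsHermitian :=
    Matrix.IsHermitian.sub (cfc_predicate _ ρ) (cfc_predicate _ σ)
  rw [qrelDeriv, mul_assoc, Matrix.trace_sub, Complex.sub_im, trace_mul_im_eq_zero h1 hl,
    trace_mul_im_eq_zero h2 (isHermitian_mul_pinv hρ hσ hc), sub_zero]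

/-- The `χ²` quadratic form at `ρ`. -/
noncomputable def chiSq {d : ℕ} (ρ : Op d) (x : Op d × Op d) : ℂ :=
  ((x.1 - x.2) ^ 2 * pinv ρ).trace

theorem chiSq_smul {d : ℕ} (ρ : Op d) (c : ℝ) (x : Op d × Op d) :
    chiSq ρ (c • x) = c ^ 2 • chiSq ρ x := by
  simp only [chiSq, Prod.smul_fst, Prod.smul_snd, ← smul_sub, smul_pow, smul_mul_assoc,
    Matrix.trace_smul]

theorem continuous_chiSq {d : ℕ} (ρ : Op d) : Continuous (chiSq ρ) := by
  unfold chiSq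
  fun_prop

theorem chiSq_im {d : ℕ} (ρ : Op d) {x : Op d × Op d} (h1 : x.1.IsHermitian)
    (h2 : x.2.IsHermitian) : (chiSq ρ x).im = 0 :=
  trace_mul_im_eq_zero ((h1.sub h2).pow 2) (cfc_predicate (fun x : ℝ => x⁻¹) ρ)

end QuantumStat

/-! ### Assembly -/

open QuantumStat in
theorem mainTheorem10 {d : ℕ} {Ω Ω' : Type*} [MeasurableSpace Ω] [MeasurableSpace Ω']
    (P : Measure Ω) [IsProbabilityMeasure P] (P' : Measure Ω') [IsProbabilityMeasure P']
    -- the deterministic density operators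
    (ρ σ : QuantumStat.Op d)
    (hρ : QuantumStat.IsDensityOperator ρ) (hσ : QuantumStat.IsDensityOperator σ)
    -- the random density operators
    (ρn σn : ℕ → Ω → QuantumStat.Op d)
    (hρn_meas : ∀ n, Measurable (ρn n)) (hσn_meas : ∀ n, Measurable (σn n))
    (hρn : ∀ n ω, QuantumStat.IsDensityOperator (ρn n ω))
    (hσn : ∀ n ω, QuantumStat.IsDensityOperator (σn n ω))
    -- the diverging positive rate
    (r : ℕ → ℝ) (hr_pos : ∀ n, 0 < r n) (hr : Tendsto r atTop atTop)
    -- the support conditions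
    (h_supp : ∀ n, ∀ᵐ ω ∂P, QuantumStat.SuppLE (ρn n ω) (σn n ω) ∧
      QuantumStat.SuppLE (σn n ω) σ ∧ QuantumStat.SuppLE (ρn n ω) ρ)
    (h_supp_lim : QuantumStat.SuppLE ρ σ)
    -- the operators commute
    (h_comm : ∀ n, ∀ᵐ ω ∂P, Commute (ρn n ω) (σn n ω) ∧
      Commute (ρn n ω) ρ ∧ Commute (ρn n ω) σ ∧ Commute (σn n ω) ρ ∧ Commute (σn n ω) σ)
    (h_comm_lim : Commute ρ σ)
    -- joint weak convergence of the rescaled errors to the random pair `(L₁, L₂)`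
    (L₁ L₂ : Ω' → QuantumStat.Op d)
    (h_conv : TendstoInDistribution
      (fun n ω => (r n • (ρn n ω - ρ), r n • (σn n ω - σ))) atTop
      (fun ω => (L₁ ω, L₂ ω)) (fun _ => P) P') :
    -- the relative entropies are finite, so that `toReal` below reads off their values
    (QuantumStat.qrel ρ σ ≠ ⊤ ∧ ∀ n, ∀ᵐ ω ∂P, QuantumStat.qrel (ρn n ω) (σn n ω) ≠ ⊤) ∧
    -- the general limit; its trace is almost surely a real number
    ((∀ᵐ ω ∂P', (L₁ ω * (QuantumStat.opLog ρ - QuantumStat.opLog σ)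
        - L₂ ω * ρ * QuantumStat.pinv σ).trace.im = 0) ∧
      TendstoInDistribution
        (fun n ω => r n *
          ((QuantumStat.qrel (ρn n ω) (σn n ω)).toReal - (QuantumStat.qrel ρ σ).toReal)) atTop
        (fun ω => (L₁ ω * (QuantumStat.opLog ρ - QuantumStat.opLog σ)
          - L₂ ω * ρ * QuantumStat.pinv σ).trace.re) (fun _ => P) P') ∧
    -- the null case
    (ρ = σ →
      (∀ᵐ ω ∂P', ((L₁ ω - L₂ ω) ^ 2 * QuantumStat.pinv ρ).trace.im = 0) ∧
      TendstoInDistribution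
        (fun n ω => r n ^ 2 * (QuantumStat.qrel (ρn n ω) (σn n ω)).toReal) atTop
        (fun ω => (1 / 2 : ℝ) * ((L₁ ω - L₂ ω) ^ 2 * QuantumStat.pinv ρ).trace.re)
        (fun _ => P) P') := by
  have hZ : ∀ n ω, (r n • (ρn n ω - ρ), r n • (σn n ω - σ))
      = r n • (ρn n ω - ρ, σn n ω - σ) := fun n ω => rfl
  have hherm : ∀ n ω, (r n • (ρn n ω - ρ)).IsHermitian ∧ (r n • (σn n ω - σ)).IsHermitian :=
    fun n ω => ⟨((hρn n ω).1.1.sub hρ.1.1).smul (IsSelfAdjoint.all _),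
      ((hσn n ω).1.1.sub hσ.1.1).smul (IsSelfAdjoint.all _)⟩
  have hmeas : ∀ n, AEMeasurable (fun ω => (qrel (ρn n ω) (σn n ω)).toReal) P := fun n =>
    aemeasurable_toReal_qrel (hρn_meas n) (hσn_meas n) (hρn n) (hσn n)
      ((h_supp n).mono fun ω h => h.1)
  refine ⟨⟨qrel_ne_top h_supp_lim, fun n => (h_supp n).mono fun ω h => qrel_ne_top h.1⟩,
    ⟨?_, ?_⟩, ?_⟩
  · exact ae_mem_of_tendstoInDistribution h_conv
      (isClosed_eq (Complex.continuous_im.comp (continuous_qrelDeriv ρ σ)) continuous_const)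
      fun n => ae_of_all _ fun ω =>
        qrelDeriv_im hρ.1.1 hσ.1.1 h_comm_lim (hherm n ω).1 (hherm n ω).2
  · obtain ⟨C, -, δ, hδ, hle⟩ := exists_qrel_first_order hρ hσ h_supp_lim h_comm_lim
    refine tendstoInDistribution_of_abs_sub_le (L := fun ω => (L₁ ω, L₂ ω))
      (X := fun n ω => r n * ((qrel (ρn n ω) (σn n ω)).toReal - (qrel ρ σ).toReal))
      (Φ := fun x => (qrelDeriv ρ σ x).re) (G := fun x => C * sqSize x) h_conv
      (Complex.continuous_re.comp (continuous_qrelDeriv ρ σ)) (continuous_sqSize.const_mul C)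
      continuous_sqSize hr hδ (fun n => ((hmeas n).sub_const _).const_mul _) fun n => ?_
    filter_upwards [h_supp n, h_comm n] with ω ⟨hs1, _, hs3⟩ ⟨c1, c2, c3, c4, c5⟩ hN
    have hr0 := hr_pos n
    -- Homogeneity of degree two cancels the rate, leaving the smallness condition on the unscaled
    -- errors.
    rw [hZ, sqSize_smul, inv_pow, inv_mul_cancel_left₀ (by positivity)] at hN
    have h := hle _ _ (hρn n ω) (hσn n ω) hs1 hs3 c1 c2 c3 c4 c5 hN
    rw [hZ, qrelDeriv_smul, sqSize_smul, Complex.smul_re, smul_eq_mul, ← mul_sub, abs_mul,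
      abs_of_pos hr0]
    calc _ ≤ r n * (C * sqSize (ρn n ω - ρ, σn n ω - σ)) := by gcongr; exact h
      -- Writing `N` for the unscaled `sqSize`, `r * N = r⁻¹ * (r ^ 2 * N)`.
      _ = _ := by field_simp
  · rintro rfl
    refine ⟨?_, ?_⟩
    · exact ae_mem_of_tendstoInDistribution h_conv
        (isClosed_eq (Complex.continuous_im.comp (continuous_chiSq ρ)) continuous_const)
        fun n => ae_of_all _ fun ω => chiSq_im ρ (hherm n ω).1 (hherm n ω).2
    · obtain ⟨C, -, δ, hδ, hle⟩ := exists_qrel_second_order hρ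
      refine tendstoInDistribution_of_abs_sub_le (L := fun ω => (L₁ ω, L₂ ω))
        (X := fun n ω => r n ^ 2 * (qrel (ρn n ω) (σn n ω)).toReal)
        (Φ := fun x => 1 / 2 * (chiSq ρ x).re)
        (G := fun x => C * (sqSize x * √(sqSize x))) h_conv
        ((Complex.continuous_re.comp (continuous_chiSq ρ)).const_mul _)
        ((continuous_sqSize.mul continuous_sqSize.sqrt).const_mul C)
        continuous_sqSize hr hδ (fun n => (hmeas n).const_mul _) fun n => ?_
      filter_upwards [h_supp n, h_comm n] with ω ⟨hs1, hs2, _⟩ ⟨c1, c2, _, c4, _⟩ hN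
      have hr0 := hr_pos n
      rw [hZ, sqSize_smul, inv_pow, inv_mul_cancel_left₀ (by positivity)] at hN
      have h := hle _ _ (hρn n ω) (hσn n ω) hs1 hs2 c1 c2 c4 hN
      rw [hZ, chiSq_smul, sqSize_smul, Complex.smul_re, smul_eq_mul, mul_left_comm, ← mul_sub,
        abs_mul, abs_of_pos (by positivity), Real.sqrt_mul (by positivity), Real.sqrt_sq hr0.le]
      calc _ ≤ r n ^ 2 * (C * (sqSize (ρn n ω - ρ, σn n ω - ρ)
            * √(sqSize (ρn n ω - ρ, σn n ω - ρ)))) := by gcongr; exact h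
        -- With the same `N`, `r ^ 2 * (N * √N) = r⁻¹ * (r ^ 2 * N * (r * √N))`.
        _ = _ := by field_simp
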